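/- **Theorem (weak completeness of $K45(\mathbf G)$).** Let $V$ be a countable set of propositional variables and let $\mathcal L_{\Box\Diamond}(V)$ be the set of formulas built from $V$, the constant $\bot$, the binary connectives $\wedge,\to$ and the unary operators $\Box,\Diamond$. Abbreviate $\top:=\bot\to\bot$, $\neg\varphi:=\varphi\to\bot$ and $\varphi\vee\psi:=((\varphi\to\psi)\to\psi)\wedge((\psi\to\varphi)\to\varphi)$. The logic $K45(\mathbf G)$ is the smallest set of formulas that contains all instances of - the axioms of Gödel logic: $(\varphi\to\psi)\to((\psi\to\chi)\to(\varphi\to\chi))$; $(\varphi\wedge\psi)\to\varphi$; $(\varphi\wedge\psi)\to(\psi\wedge\varphi)$; $(\varphi\to(\psi\to\chi))\to((\varphi\wedge\psi)\to\chi)$; $((\varphi\wedge\psi)\to\chi)\to(\varphi\to(\psi\to\chi))$; $\varphi\to(\varphi\wedge\varphi)$; $((\varphi\to\psi)\to\chi)\to(((\psi\to\varphi)\to\chi)\to\chi)$; $\bot\to\varphi$; - the axioms of the modal logic $K(\mathbf G)$: $\Box(\varphi\to\psi)\to(\Box\varphi\to\Box\psi)$; $\Diamond(\varphi\vee\psi)\to(\Diamond\varphi\vee\Diamond\psi)$;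 $\Box\top$; $\neg\Diamond\bot$; $\Box(\varphi\to\psi)\to(\Diamond\varphi\to\Diamond\psi)$; $(\Diamond\varphi\to\Box\psi)\to\Box(\varphi\to\psi)$; - $\Box\varphi\to\Box\Box\varphi$; $\Diamond\Diamond\varphi\to\Diamond\varphi$; $\Diamond\Box\varphi\to\Box\varphi$; $\Diamond\varphi\to\Box\Diamond\varphi$; and is closed under modus ponens (from $\varphi\to\psi$ and $\varphi$ infer $\psi$) and necessitation (from $\varphi$ infer $\Box\varphi$). Write $\vdash_{K45(\mathbf G)}\varphi$ if $\varphi$ belongs to it. A possibilistic Gödel–Kripke model is a triple $\langle W,\pi,e\rangle$, where $W$ is a non-empty set and $\pi:W\to[0,1]$ and $e:W\times V\to[0,1]$ are arbitrary maps ($\pi$ need not be normalised, i.e. $\sup_w\pi(w)=1$ is not required). Let $x\Rightarrow y:=1$ if $x\le y$, and $x\Rightarrow y:=y$ otherwise. The map $e$ extends to all formulas by $e(w,\bot)=0$, $e(w,\varphi\wedge\psi)=\min(e(w,\varphi),e(w,\psi))$, $e(w,\varphi\to\psi)=e(w,\varphi)\Rightarrow e(w,\psi)$ and $$e(w,\Box\varphi)=\inf_{w'\in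 W}\bigl(\pi(w')\Rightarrow e(w',\varphi)\bigr),\qquad e(w,\Diamond\varphi)=\sup_{w'\in W}\min\bigl(\pi(w'),e(w',\varphi)\bigr).$$ A formula $\varphi$ is valid in $\langle W,\pi,e\rangle$ if $e(w,\varphi)=1$ for all $w\in W$; write $\models_{\Pi\mathcal G}\varphi$ if $\varphi$ is valid in every possibilistic Gödel–Kripke model. Then for every formula $\varphi\in\mathcal L_{\Box\Diamond}(V)$, $$\models_{\Pi\mathcal G}\varphi\quad\text{if and only if}\quad\vdash_{K45(\mathbf G)}\varphi .$$ -/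

import Mathlib

universe u w

/-- Formulas of the bimodal Gödel language over the propositional variables `V`: the primitive
symbols are `⊥`, conjunction, implication, `□` and `◇`. -/
inductive Formula (V : Type u) : Type u
  | var : V → Formula V
  | bot : Formula V
  | and : Formula V → Formula V → Formula V
  | imp : Formula V → Formula V → Formula V
  | box : Formula V → Formula V
  | dia : Formula V → Formula V

namespace Formula

variable {V : Type u}

/-- `⊤` is `⊥ → ⊥`. -/
def top : Formula V := imp bot bot

/-- `¬ φ` is `φ → ⊥`. -/
def neg (φ : Formula V) : Formula V := imp φ bot

/-- `φ ∨ ψ` is `((φ → ψ) → ψ) ∧ ((ψ → φ) → φ)`. -/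
def or (φ ψ : Formula V) : Formula V := and (imp (imp φ ψ) ψ) (imp (imp ψ φ) φ)

end Formula

open Formula in
/-- `K45G φ`: the formula `φ` is a theorem of the Hilbert calculus `K45(G)` (no assumptions). -/
inductive K45G {V : Type u} : Formula V → Prop
  -- Gödel propositional logic
  | a1 (φ ψ χ : Formula V) : K45G (imp (imp φ ψ) (imp (imp ψ χ) (imp φ χ)))
  | a2 (φ ψ : Formula V) : K45G (imp (and φ ψ) φ)
  | a3 (φ ψ : Formula V) : K45G (imp (and φ ψ) (and ψ φ))
  | a4a (φ ψ χ : Formula V) : K45G (imp (imp φ (imp ψ χ)) (imp (and φ ψ) χ))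
  | a4b (φ ψ χ : Formula V) : K45G (imp (imp (and φ ψ) χ) (imp φ (imp ψ χ)))
  | a6 (φ : Formula V) : K45G (imp φ (and φ φ))
  | a7 (φ ψ χ : Formula V) :
      K45G (imp (imp (imp φ ψ) χ) (imp (imp (imp ψ φ) χ) χ))
  | a8 (φ : Formula V) : K45G (imp bot φ)
  -- the minimal bimodal Gödel logic
  | kBox (φ ψ : Formula V) : K45G (imp (box (imp φ ψ)) (imp (box φ) (box ψ)))
  | kDia (φ ψ : Formula V) : K45G (imp (dia (or φ ψ)) (or (dia φ) (dia ψ)))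
  | fBox : K45G (box top)
  | fDia : K45G (neg (dia bot))
  | p (φ ψ : Formula V) : K45G (imp (box (imp φ ψ)) (imp (dia φ) (dia ψ)))
  | fs2 (φ ψ : Formula V) : K45G (imp (imp (dia φ) (box ψ)) (box (imp φ ψ)))
  -- positive and negative introspection
  | fourBox (φ : Formula V) : K45G (imp (box φ) (box (box φ)))
  | fourDia (φ : Formula V) : K45G (imp (dia (dia φ)) (dia φ))
  | fiveBox (φ : Formula V) : K45G (imp (dia (box φ)) (box φ))
  | fiveDia (φ : Formula V) : K45G (imp (dia φ) (box (dia φ)))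
  -- modus ponens and necessitation
  | mp {φ ψ : Formula V} : K45G (imp φ ψ) → K45G φ → K45G ψ
  | nec {φ : Formula V} : K45G φ → K45G (box φ)

open Classical in
/-- Gödel implication on `[0, 1]`: `x ⇒ y` is `1` if `x ≤ y`, and `y` otherwise. -/
noncomputable def godelImp (x y : unitInterval) : unitInterval := if x ≤ y then 1 else y

/-- A possibilistic Gödel–Kripke model `⟨W, π, e⟩`: a non-empty set `W` of worlds, an arbitrary
(not necessarily normalised) possibility distribution `π : W → [0, 1]`, and an assignment
`e : W × V → [0, 1]`. -/
structure PiGModel (V : Type u) where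
  /-- the worlds -/
  W : Type w
  nonempty : Nonempty W
  /-- the possibility distribution -/
  π : W → unitInterval
  /-- the evaluation of the variables -/
  e : W → V → unitInterval

namespace PiGModel

/-- The extension of `e` to all formulas; infima and suprema are taken in `[0, 1]`. -/
noncomputable def eval {V : Type u} (M : PiGModel.{u, w} V) :
    Formula V → M.W → unitInterval
  | .var x, v => M.e v x
  | .bot, _ => 0
  | .and φ ψ, v => min (M.eval φ v) (M.eval ψ v)
  | .imp φ ψ, v => godelImp (M.eval φ v) (M.eval ψ v)
  | .box φ, _ => ⨅ v' : M.W, godelImp (M.π v') (M.eval φ v')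
  | .dia φ, _ => ⨆ v' : M.W, min (M.π v') (M.eval φ v')

/-- `φ` is valid in `M` if it takes the value `1` in every world. -/
def Valid {V : Type u} (M : PiGModel.{u, w} V) (φ : Formula V) : Prop :=
  ∀ v : M.W, M.eval φ v = 1

end PiGModel

/-- `φ` is valid in all possibilistic Gödel–Kripke models. -/
def PiGValid {V : Type u} (φ : Formula V) : Prop :=
  ∀ M : PiGModel.{u, w} V, M.Valid φ

section

variable {V : Type u}

/-! ### The Gödel implication on the unit interval -/

/-! Soundness: residuation turns each axiom into a lattice inequality. The four introspection axioms
hold because the value of a boxed or diamond formula does not depend on the world.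

Completeness: if `φ` is not derivable, a Lindenbaum argument gives a linear theory omitting `φ`. Its
order of provable implication is a countable total preorder, hence embeds in the unit interval as a
valuation `v` with value `1` on all theorems and `v φ < 1`; modal formulas are atoms for `v`
(`exists_isK45Hom_lt_one`). The worlds of the countermodel are all such propositional valuations
`u`. The degree of `u` is the largest `a` for which `v (□ψ)` is at most `u ψ` and `u ψ` is at most
`v (◇ψ)` after cutting the smaller-to-be side at `a`, for `ψ` in a finite fragment. The truth lemma
`canonicalModel_eval` says that every box and diamond of the fragment takes its `v`-value
everywhere, and that other formulas are correct up to the cut-off at the degree of the world. An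
added world of degree `0` copies `v` and refutes `φ`.

The truth lemma needs valuations that witness the infimum and the supremum
(`IsK45Hom.exists_box_witness`, `IsK45Hom.exists_dia_witness`). A linear theory provides a valuation
with the right order but the wrong values. A strictly increasing map of the unit interval fixing the
endpoints preserves Gödel valuations, so the values can be corrected by interpolating between
finitely many bounds (`IsAccessible.exists_rescaling`). This is why the fragment must be finite. -/

theorem le_godelImp_iff {a b c : unitInterval} : a ≤ godelImp b c ↔ min a b ≤ c := by
  unfold godelImp
  split_ifs with h
  · exact ⟨fun _ => (min_le_right _ _).trans h, fun _ => unitInterval.le_one'⟩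
  · refine ⟨fun h' => (min_le_left _ _).trans h', fun h' => ?_⟩
    rcases min_le_iff.1 h' with h' | h'
    · exact h'
    · exact absurd h' h

theorem godelImp_eq_one_iff {a b : unitInterval} : godelImp a b = 1 ↔ a ≤ b := by
  have h := le_godelImp_iff (a := 1) (b := a) (c := b)
  rw [min_eq_right unitInterval.le_one'] at h
  exact ⟨fun h' => h.1 h'.ge, fun h' => le_antisymm unitInterval.le_one' (h.2 h')⟩

theorem godelImp_of_le {a b : unitInterval} (h : a ≤ b) : godelImp a b = 1 :=
  godelImp_eq_one_iff.2 h

theorem godelImp_of_lt {a b : unitInterval} (h : b < a) : godelImp a b = b :=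
  if_neg h.not_ge

theorem le_godelImp_right (a b : unitInterval) : b ≤ godelImp a b :=
  le_godelImp_iff.2 (min_le_left _ _)

theorem min_godelImp_le (a b : unitInterval) : min a (godelImp a b) ≤ b := by
  rw [min_comm]; exact le_godelImp_iff.1 le_rfl

theorem max_eq_min_godelImp (a b : unitInterval) :
    min (godelImp (godelImp a b) b) (godelImp (godelImp b a) a) = max a b := by
  rcases lt_trichotomy a b with h | h | h
  · rw [godelImp_of_le h.le, godelImp_of_lt h, godelImp_of_le (le_refl a), max_eq_right h.le]
    rcases eq_or_lt_of_le (unitInterval.le_one' (t := b)) with h1 | h1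
    · rw [h1, godelImp_of_le le_rfl, min_self]
    · rw [godelImp_of_lt h1, min_eq_left h1.le]
  · subst h
    rw [godelImp_of_le (le_refl a), min_self, max_self]
    rcases eq_or_lt_of_le (unitInterval.le_one' (t := a)) with h1 | h1
    · rw [h1, godelImp_of_le le_rfl]
    · rw [godelImp_of_lt h1]
  · rw [godelImp_of_le h.le, godelImp_of_lt h, godelImp_of_le (le_refl b), max_eq_left h.le]
    rcases eq_or_lt_of_le (unitInterval.le_one' (t := a)) with h1 | h1
    · rw [h1, godelImp_of_le le_rfl, min_self]
    · rw [godelImp_of_lt h1, min_eq_right h1.le]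

/-- Cutting off at `r` is compatible with the Gödel implication. -/
theorem min_godelImp_congr {r a b a' b' : unitInterval} (ha : min r a = min r a')
    (hb : min r b = min r b') : min r (godelImp a b) = min r (godelImp a' b') := by
  have key : ∀ {a b a' b' : unitInterval}, min r a = min r a' → min r b = min r b' →
      min r (godelImp a b) ≤ godelImp a' b' := by
    intro a b a' b' ha hb
    rw [le_godelImp_iff]
    calc min (min r (godelImp a b)) a' = min (min r a') (godelImp a b) := min_right_comm _ _ _
      _ = min r (min a (godelImp a b)) := by rw [← ha, min_assoc]
      _ ≤ min r b := min_le_min_left _ (min_godelImp_le _ _)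
      _ ≤ b' := hb ▸ min_le_right _ _
  exact le_antisymm (le_min (min_le_left _ _) (key ha hb))
    (le_min (min_le_left _ _) (key ha.symm hb.symm))

/-! ### Soundness -/

namespace PiGModel

variable (M : PiGModel.{u, w} V)

theorem box_inf_le (φ : Formula V) (v v' : M.W) :
    min (M.eval φ.box v) (M.π v') ≤ M.eval φ v' :=
  le_godelImp_iff.1 (iInf_le (fun v' => godelImp (M.π v') (M.eval φ v')) v')

theorem le_dia (φ : Formula V) (v v' : M.W) :
    min (M.π v') (M.eval φ v') ≤ M.eval φ.dia v :=
  le_iSup (fun v' => min (M.π v') (M.eval φ v')) v'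

theorem le_box {φ : Formula V} {v : M.W} {a : unitInterval}
    (h : ∀ v', min a (M.π v') ≤ M.eval φ v') : a ≤ M.eval φ.box v :=
  le_iInf fun v' => le_godelImp_iff.2 (h v')

theorem dia_le {φ : Formula V} {v : M.W} {a : unitInterval}
    (h : ∀ v', min (M.π v') (M.eval φ v') ≤ a) : M.eval φ.dia v ≤ a :=
  iSup_le h

theorem eval_or (φ ψ : Formula V) (v : M.W) :
    M.eval (φ.or ψ) v = max (M.eval φ v) (M.eval ψ v) :=
  max_eq_min_godelImp _ _

theorem eval_imp_eq_one {φ ψ : Formula V} {v : M.W} :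
    M.eval (φ.imp ψ) v = 1 ↔ M.eval φ v ≤ M.eval ψ v :=
  godelImp_eq_one_iff

theorem le_eval_imp {φ ψ : Formula V} {v : M.W} {a : unitInterval} :
    a ≤ M.eval (φ.imp ψ) v ↔ min a (M.eval φ v) ≤ M.eval ψ v :=
  le_godelImp_iff

theorem min_eval_imp_le (φ ψ : Formula V) (v : M.W) :
    min (M.eval φ v) (M.eval (φ.imp ψ) v) ≤ M.eval ψ v :=
  min_godelImp_le _ _

end PiGModel

theorem K45G.valid (M : PiGModel.{u, w} V) {φ : Formula V} (h : K45G φ) : M.Valid φ := by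
  induction h with
  | a1 φ ψ χ =>
    intro v
    rw [M.eval_imp_eq_one, M.le_eval_imp, M.le_eval_imp]
    have h1 := M.min_eval_imp_le φ ψ v
    have h2 := M.min_eval_imp_le ψ χ v
    grind
  | a2 φ ψ => exact fun v => M.eval_imp_eq_one.2 (min_le_left _ _)
  | a3 φ ψ => exact fun v => M.eval_imp_eq_one.2 (min_comm _ _).le
  | a4a φ ψ χ =>
    intro v
    rw [M.eval_imp_eq_one, M.le_eval_imp]
    have h1 := M.min_eval_imp_le φ (ψ.imp χ) v
    have h2 := M.min_eval_imp_le ψ χ v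
    have h3 : M.eval (φ.and ψ) v = min (M.eval φ v) (M.eval ψ v) := rfl
    grind
  | a4b φ ψ χ =>
    intro v
    rw [M.eval_imp_eq_one, M.le_eval_imp, M.le_eval_imp]
    have h1 := M.min_eval_imp_le (φ.and ψ) χ v
    have h3 : M.eval (φ.and ψ) v = min (M.eval φ v) (M.eval ψ v) := rfl
    grind
  | a6 φ => exact fun v => M.eval_imp_eq_one.2 (min_self _).ge
  | a7 φ ψ χ =>
    intro v
    rw [M.eval_imp_eq_one, M.le_eval_imp]
    have h1 := M.min_eval_imp_le (φ.imp ψ) χ v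
    have h2 := M.min_eval_imp_le (ψ.imp φ) χ v
    have h5 := unitInterval.le_one' (t := M.eval ((φ.imp ψ).imp χ) v)
    have h6 := unitInterval.le_one' (t := M.eval ((ψ.imp φ).imp χ) v)
    rcases le_total (M.eval φ v) (M.eval ψ v) with h | h
    · rw [M.eval_imp_eq_one.2 h] at h1
      grind
    · rw [M.eval_imp_eq_one.2 h] at h2
      grind
  | a8 φ => exact fun v => M.eval_imp_eq_one.2 unitInterval.nonneg'
  | kBox φ ψ =>
    intro v
    rw [M.eval_imp_eq_one, M.le_eval_imp]
    refine M.le_box fun v' => ?_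
    have h1 := M.box_inf_le (φ.imp ψ) v v'
    have h2 := M.box_inf_le φ v v'
    have h3 := M.min_eval_imp_le φ ψ v'
    grind
  | kDia φ ψ =>
    intro v
    rw [M.eval_imp_eq_one, M.eval_or]
    refine M.dia_le fun v' => ?_
    rw [M.eval_or]
    have h1 := M.le_dia φ v v'
    have h2 := M.le_dia ψ v v'
    grind
  | fBox =>
    refine fun v => le_antisymm unitInterval.le_one' (M.le_box fun v' => ?_)
    rw [show M.eval Formula.top v' = 1 from M.eval_imp_eq_one.2 le_rfl]
    exact unitInterval.le_one'
  | fDia =>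
    exact fun v => M.eval_imp_eq_one.2 (M.dia_le fun v' => min_le_right _ _)
  | p φ ψ =>
    intro v
    rw [M.eval_imp_eq_one, M.le_eval_imp, min_comm, ← le_godelImp_iff]
    refine M.dia_le fun v' => ?_
    rw [le_godelImp_iff]
    have h1 := M.box_inf_le (φ.imp ψ) v v'
    have h2 := M.le_dia ψ v v'
    have h3 := M.min_eval_imp_le φ ψ v'
    grind
  | fs2 φ ψ =>
    intro v
    rw [M.eval_imp_eq_one]
    refine M.le_box fun v' => ?_
    rw [M.le_eval_imp]
    have h1 := M.box_inf_le ψ v v'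
    have h2 := M.le_dia φ v v'
    have h3 := M.min_eval_imp_le φ.dia ψ.box v
    grind
  | fourBox φ => exact fun v => M.eval_imp_eq_one.2 (M.le_box fun v' => min_le_left _ _)
  | fourDia φ => exact fun v => M.eval_imp_eq_one.2 (M.dia_le fun v' => min_le_right _ _)
  | fiveBox φ => exact fun v => M.eval_imp_eq_one.2 (M.dia_le fun v' => min_le_right _ _)
  | fiveDia φ => exact fun v => M.eval_imp_eq_one.2 (M.le_box fun v' => min_le_left _ _)
  | mp _ _ ih1 ih2 =>
    intro v
    have := M.eval_imp_eq_one.1 (ih1 v)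
    rw [ih2 v] at this
    exact le_antisymm unitInterval.le_one' this
  | nec _ ih =>
    intro v
    refine le_antisymm unitInterval.le_one' (M.le_box fun v' => ?_)
    rw [ih v']
    exact unitInterval.le_one'

/-! ### Derivations in the Gödel fragment -/

namespace K45G

variable {φ ψ χ : Formula V}

theorem trans (h1 : K45G (φ.imp ψ)) (h2 : K45G (ψ.imp χ)) : K45G (φ.imp χ) :=
  ((a1 φ ψ χ).mp h1).mp h2

theorem refl (φ : Formula V) : K45G (φ.imp φ) := (a6 φ).trans (a2 φ φ)

theorem weaken (φ ψ : Formula V) : K45G (φ.imp (ψ.imp φ)) := (a4b _ _ _).mp (a2 φ ψ)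

theorem and_right (φ ψ : Formula V) : K45G ((φ.and ψ).imp ψ) := (a3 φ ψ).trans (a2 ψ φ)

theorem pair (φ ψ : Formula V) : K45G (φ.imp (ψ.imp (φ.and ψ))) := (a4b _ _ _).mp (refl _)

theorem exchange (φ ψ χ : Formula V) :
    K45G ((φ.imp (ψ.imp χ)).imp (ψ.imp (φ.imp χ))) :=
  ((a4a φ ψ χ).trans ((a1 _ _ χ).mp (a3 ψ φ))).trans (a4b ψ φ χ)

theorem contract (φ ψ : Formula V) : K45G ((φ.imp (φ.imp ψ)).imp (φ.imp ψ)) :=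
  (a4a φ φ ψ).trans ((a1 _ _ ψ).mp (a6 φ))

theorem top (V : Type u) : K45G (Formula.top : Formula V) := refl _

end K45G

/-! ### Theories and the Lindenbaum extension. -/

/-- A set of formulas that contains the theorems of `K45(G)` and is closed under modus ponens. -/
structure IsTheory (T : Set (Formula V)) : Prop where
  of_thm {φ : Formula V} : K45G φ → φ ∈ T
  mp {φ ψ : Formula V} : φ.imp ψ ∈ T → φ ∈ T → ψ ∈ T

namespace IsTheory

variable {T : Set (Formula V)} {φ ψ χ : Formula V}

theorem trans (hT : IsTheory T) (h1 : φ.imp ψ ∈ T) (h2 : ψ.imp χ ∈ T) : φ.imp χ ∈ T :=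
  hT.mp (hT.mp (hT.of_thm (.a1 φ ψ χ)) h1) h2

theorem imp_of_mem (hT : IsTheory T) (h : ψ ∈ T) : φ.imp ψ ∈ T :=
  hT.mp (hT.of_thm (.weaken ψ φ)) h

theorem imp_and (hT : IsTheory T) (h1 : φ.imp ψ ∈ T) (h2 : φ.imp χ ∈ T) :
    φ.imp (ψ.and χ) ∈ T := by
  have h3 : φ.imp (χ.imp (ψ.and χ)) ∈ T := hT.trans h1 (hT.of_thm (.pair ψ χ))
  have h4 : χ.imp (φ.imp (ψ.and χ)) ∈ T := hT.mp (hT.of_thm (.exchange _ _ _)) h3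
  exact hT.mp (hT.of_thm (.contract _ _)) (hT.trans h2 h4)

theorem imp_mp (hT : IsTheory T) (h1 : φ.imp (ψ.imp χ) ∈ T) (h2 : φ.imp ψ ∈ T) :
    φ.imp χ ∈ T :=
  hT.trans (hT.imp_and (hT.of_thm (.refl φ)) h2) (hT.mp (hT.of_thm (.a4a _ _ _)) h1)

/-- The theory generated by a theory and one further formula. -/
theorem adjoin (hT : IsTheory T) (φ : Formula V) : IsTheory {ψ | φ.imp ψ ∈ T} where
  of_thm h := hT.imp_of_mem (hT.of_thm h)
  mp h1 h2 := hT.imp_mp h1 h2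

/-- Lindenbaum: a theory that avoids a directed set of formulas extends to a linear one. -/
theorem exists_linear (hT : IsTheory T) {U : Set (Formula V)}
    (hU : ∀ a ∈ U, ∀ b ∈ U, ∃ c ∈ U, K45G (a.imp c) ∧ K45G (b.imp c))
    (hTU : ∀ a ∈ U, a ∉ T) :
    ∃ S, T ⊆ S ∧ IsTheory S ∧ (∀ a ∈ U, a ∉ S) ∧
      ∀ ψ χ : Formula V, ψ.imp χ ∈ S ∨ χ.imp ψ ∈ S := by
  obtain ⟨S, hTS, hS⟩ := zorn_subset_nonempty
    {S : Set (Formula V) | IsTheory S ∧ ∀ a ∈ U, a ∉ S} (by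
      intro c hc hchain hne
      refine ⟨⋃₀ c, ⟨⟨fun h => ?_, fun {φ ψ} h1 h2 => ?_⟩, ?_⟩,
        fun s hs => Set.subset_sUnion_of_mem hs⟩
      · obtain ⟨s, hs⟩ := hne
        exact ⟨s, hs, (hc hs).1.of_thm h⟩
      · obtain ⟨s1, hs1, h1⟩ := h1
        obtain ⟨s2, hs2, h2⟩ := h2
        rcases hchain.total hs1 hs2 with h | h
        · exact ⟨s2, hs2, (hc hs2).1.mp (h h1) h2⟩
        · exact ⟨s1, hs1, (hc hs1).1.mp h1 (h h2)⟩
      · rintro a ha ⟨s, hs, has⟩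
        exact (hc hs).2 a ha has) T ⟨hT, hTU⟩
  refine ⟨S, hTS, hS.prop.1, hS.prop.2, fun ψ χ => ?_⟩
  have hth := hS.prop.1
  -- By maximality, adjoining a formula outside `S` produces a theory that meets `U`.
  have key : ∀ θ : Formula V, θ ∉ S → ∃ a ∈ U, θ.imp a ∈ S := by
    intro θ hθ
    by_contra! hcon
    have hmem : {ψ | θ.imp ψ ∈ S} ∈ {S : Set (Formula V) | IsTheory S ∧ ∀ a ∈ U, a ∉ S} :=
      ⟨hth.adjoin θ, hcon⟩
    exact hθ (hS.le_of_ge hmem (fun _ h => hth.imp_of_mem h) (hth.of_thm (.refl θ)))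
  by_contra! hcon
  obtain ⟨a, ha, ha'⟩ := key _ hcon.1
  obtain ⟨b, hb, hb'⟩ := key _ hcon.2
  obtain ⟨c, hc, hac, hbc⟩ := hU a ha b hb
  -- Both `ψ → χ` and `χ → ψ` imply `c`, so prelinearity puts `c` itself into `S`.
  exact hS.prop.2 c hc (hth.mp (hth.mp (hth.of_thm (.a7 ψ χ c))
    (hth.trans ha' (hth.of_thm hac))) (hth.trans hb' (hth.of_thm hbc)))

end IsTheory

/-! ### Linear theories as Gödel valuations -/

/-- A map on formulas that respects the propositional connectives, modal formulas being treated
as atoms. -/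
structure IsGodelHom (u : Formula V → unitInterval) : Prop where
  bot : u .bot = 0
  and (φ ψ : Formula V) : u (φ.and ψ) = min (u φ) (u ψ)
  imp (φ ψ : Formula V) : u (φ.imp ψ) = godelImp (u φ) (u ψ)

namespace IsGodelHom

variable {u : Formula V → unitInterval}

theorem imp_eq_one (hu : IsGodelHom u) {φ ψ : Formula V} : u (φ.imp ψ) = 1 ↔ u φ ≤ u ψ := by
  rw [hu.imp, godelImp_eq_one_iff]

theorem or (hu : IsGodelHom u) (φ ψ : Formula V) : u (φ.or ψ) = max (u φ) (u ψ) := by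
  simp only [Formula.or, hu.and, hu.imp, max_eq_min_godelImp]

/-- Composing with a strictly increasing map that fixes the endpoints. -/
theorem comp (hu : IsGodelHom u) {g : unitInterval → unitInterval} (hg : StrictMono g)
    (h0 : g 0 = 0) (h1 : g 1 = 1) : IsGodelHom (g ∘ u) where
  bot := by simp [hu.bot, h0]
  and φ ψ := by simp [hu.and, hg.monotone.map_min]
  imp φ ψ := by
    simp only [Function.comp, hu.imp, godelImp, hg.le_iff_le]
    split_ifs <;> simp [h1]

end IsGodelHom

/-! ### Countability of the set of formulas. -/

namespace Formula

/-- An enumeration of the formulas over an enumerated set of variables. -/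
def code (f : V → ℕ) : Formula V → ℕ
  | var x => Nat.pair 0 (f x)
  | bot => Nat.pair 1 0
  | and φ ψ => Nat.pair 2 (Nat.pair (code f φ) (code f ψ))
  | imp φ ψ => Nat.pair 3 (Nat.pair (code f φ) (code f ψ))
  | box φ => Nat.pair 4 (code f φ)
  | dia φ => Nat.pair 5 (code f φ)

theorem code_injective {f : V → ℕ} (hf : Function.Injective f) :
    Function.Injective (code f) := by
  intro φ
  induction φ with
  | var x => rintro (_ | _ | _ | _ | _ | _) <;> simp [code, hf.eq_iff]
  | bot => rintro (_ | _ | _ | _ | _ | _) <;> simp [code]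
  | and φ ψ ih1 ih2 =>
    rintro (_ | _ | _ | _ | _ | _) <;> simp [code]
    exact fun h1 h2 => ⟨ih1 h1, ih2 h2⟩
  | imp φ ψ ih1 ih2 =>
    rintro (_ | _ | _ | _ | _ | _) <;> simp [code]
    exact fun h1 h2 => ⟨ih1 h1, ih2 h2⟩
  | box φ ih =>
    rintro (_ | _ | _ | _ | _ | _) <;> simp [code]
    exact fun h => ih h
  | dia φ ih =>
    rintro (_ | _ | _ | _ | _ | _) <;> simp [code]
    exact fun h => ih h

instance [Countable V] : Countable (Formula V) :=
  let ⟨_, hf⟩ := exists_injective_nat V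
  (code_injective hf).countable

end Formula

/-- A total preorder on a countable type is represented by a real-valued function. -/
theorem exists_real_representation {α : Type*} [Countable α] (r : α → α → Prop)
    (hrefl : ∀ a, r a a) (htrans : ∀ a b c, r a b → r b c → r a c)
    (htotal : ∀ a b, r a b ∨ r b a) : ∃ t : α → ℝ, ∀ a b, t a ≤ t b ↔ r a b := by
  classical
  let _ : Preorder α := { le := r, le_refl := hrefl, le_trans := htrans }
  have : @Std.Total α (· ≤ ·) := ⟨htotal⟩
  have : Countable (Antisymmetrization α (· ≤ ·)) := by
    unfold Antisymmetrization; infer_instance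
  obtain ⟨e⟩ := Order.embedding_from_countable_to_dense
    (α := Antisymmetrization α (· ≤ ·)) (β := ℝ)
  exact ⟨fun a => e (toAntisymmetrization (· ≤ ·) a), fun a b => e.le_iff_le⟩

/-- A consistent linear theory is the set of formulas of value `1` of a Gödel valuation. -/
theorem IsTheory.exists_godelHom [Countable V] {T : Set (Formula V)} (hT : IsTheory T)
    (hlin : ∀ ψ χ : Formula V, ψ.imp χ ∈ T ∨ χ.imp ψ ∈ T) {θ : Formula V} (hθ : θ ∉ T) :
    ∃ u : Formula V → unitInterval, IsGodelHom u ∧ ∀ ψ, u ψ = 1 ↔ ψ ∈ T := by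
  obtain ⟨t, ht⟩ := exists_real_representation (fun ψ χ : Formula V => ψ.imp χ ∈ T)
    (fun a => hT.of_thm (.refl a)) (fun a b c => hT.trans) hlin
  have hbot : ∀ ψ, t .bot ≤ t ψ := fun ψ => (ht _ _).2 (hT.of_thm (.a8 ψ))
  have htop : ∀ ψ, t ψ ≤ t Formula.top :=
    fun ψ => (ht _ _).2 (hT.imp_of_mem (hT.of_thm (.top V)))
  have hone : ∀ ψ, t ψ = t Formula.top ↔ ψ ∈ T := fun ψ =>
    ⟨fun h => hT.mp ((ht _ _).1 h.ge) (hT.of_thm (.top V)),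
      fun h => le_antisymm (htop ψ) ((ht _ _).2 (hT.imp_of_mem h))⟩
  have hlt : t .bot < t Formula.top :=
    lt_of_le_of_lt (hbot θ) (lt_of_le_of_ne (htop θ) (mt (hone θ).1 hθ))
  have hpos : 0 < t Formula.top - t .bot := sub_pos.2 hlt
  let u : Formula V → unitInterval := fun ψ => ⟨(t ψ - t .bot) / (t Formula.top - t .bot),
    div_nonneg (sub_nonneg.2 (hbot ψ)) hpos.le,
    (div_le_one hpos).2 (sub_le_sub_right (htop ψ) _)⟩
  have hu : ∀ ψ χ, u ψ ≤ u χ ↔ ψ.imp χ ∈ T := fun ψ χ => by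
    rw [← ht, ← Subtype.coe_le_coe, div_le_div_iff_of_pos_right hpos, sub_le_sub_iff_right]
  have hu1 : ∀ ψ, u ψ = 1 ↔ ψ ∈ T := fun ψ => by
    rw [← hone, ← Subtype.coe_inj, Set.Icc.coe_one, div_eq_one_iff_eq hpos.ne', sub_left_inj]
  refine ⟨u, ⟨?_, fun φ ψ => ?_, fun φ ψ => ?_⟩, hu1⟩
  · ext; simp [u]
  · refine le_antisymm (le_min ((hu _ _).2 (hT.of_thm (.a2 φ ψ)))
      ((hu _ _).2 (hT.of_thm (.and_right φ ψ)))) ?_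
    rcases hlin φ ψ with h | h
    · exact (min_le_left _ _).trans ((hu _ _).2 (hT.imp_and (hT.of_thm (.refl φ)) h))
    · exact (min_le_right _ _).trans ((hu _ _).2 (hT.imp_and h (hT.of_thm (.refl ψ))))
  · unfold godelImp
    split_ifs with h
    · exact (hu1 _).2 ((hu _ _).1 h)
    · rw [hu] at h
      refine le_antisymm ((hu _ _).2 ?_) ((hu _ _).2 (hT.of_thm (.weaken ψ φ)))
      -- It remains to see `(φ → ψ) → ψ ∈ T`. Comparing `φ` with `φ → ψ`, one direction contracts to
      -- the excluded `φ → ψ`, and the other gives the claim by modus ponens under the hypothesis `φ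
      -- → ψ`.
      rcases hlin φ (φ.imp ψ) with h' | h'
      · exact absurd (hT.mp (hT.of_thm (.contract _ _)) h') h
      · exact hT.imp_mp (hT.of_thm (.refl _)) h'

/-- Avoiding a whole directed set, and not just one formula, is what the diamond witness needs:
there all formulas with a smaller diamond must stay below `1` together. -/
theorem IsTheory.exists_godelHom_extending [Countable V] {T : Set (Formula V)} (hT : IsTheory T)
    {U : Set (Formula V)} (hne : U.Nonempty)
    (hU : ∀ a ∈ U, ∀ b ∈ U, ∃ c ∈ U, K45G (a.imp c) ∧ K45G (b.imp c))
    (hTU : ∀ a ∈ U, a ∉ T) :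
    ∃ u : Formula V → unitInterval, IsGodelHom u ∧ (∀ ψ ∈ T, u ψ = 1) ∧ ∀ a ∈ U, u a < 1 := by
  obtain ⟨S, hTS, hS, hSU, hlin⟩ := hT.exists_linear hU hTU
  obtain ⟨θ, hθ⟩ := hne
  obtain ⟨u, hu, hu1⟩ := hS.exists_godelHom hlin (hSU θ hθ)
  exact ⟨u, hu, fun ψ h => (hu1 ψ).2 (hTS h),
    fun a ha => lt_of_le_of_ne unitInterval.le_one' (mt (hu1 a).1 (hSU a ha))⟩

/-- A Gödel valuation giving value `1` to all theorems of `K45(G)`. -/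
structure IsK45Hom (v : Formula V → unitInterval) : Prop extends IsGodelHom v where
  of_thm {φ : Formula V} : K45G φ → v φ = 1

theorem exists_isK45Hom_lt_one [Countable V] {φ : Formula V} (h : ¬ K45G φ) :
    ∃ v : Formula V → unitInterval, IsK45Hom v ∧ v φ < 1 := by
  obtain ⟨v, hv, h1, h2⟩ := IsTheory.exists_godelHom_extending (T := {φ : Formula V | K45G φ})
    ⟨id, .mp⟩ (U := {φ}) ⟨φ, rfl⟩
    (by rintro a rfl b rfl; exact ⟨_, rfl, .refl _, .refl _⟩) (by rintro a rfl; exact h)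
  exact ⟨v, ⟨hv, fun h => h1 _ h⟩, h2 φ rfl⟩

/-- Completeness of the propositional base: a formula is derivable if it takes the value `1` under
every Gödel valuation, modal formulas being treated as atoms. -/
theorem K45G.of_forall_godelHom [Countable V] {φ : Formula V}
    (h : ∀ u : Formula V → unitInterval, IsGodelHom u → u φ = 1) : K45G φ := by
  by_contra hφ
  obtain ⟨v, hv, hlt⟩ := exists_isK45Hom_lt_one hφ
  exact hlt.ne (h v hv.toIsGodelHom)

/-! ### Monotone interpolation -/

/-- Between monotone maps `L ≤ H` with `L x < H y` for `x < y` there is a strictly increasing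
map. -/
theorem exists_strictMono_between {L H : unitInterval → unitInterval} (hL : Monotone L)
    (hH : Monotone H) (hLH : ∀ x, L x ≤ H x) (hlt : ∀ x y, x < y → L x < H y) :
    ∃ g : unitInterval → unitInterval, StrictMono g ∧ ∀ x, L x ≤ g x ∧ g x ≤ H x := by
  -- The weight is strictly increasing with values strictly between `0` and `1`, so the convex
  -- combination `G` increases strictly even where `L` and `H` are constant.
  let t : unitInterval → ℝ := fun x => (1 + x) / 3
  have ht0 : ∀ x, 0 < t x := fun x => by have := x.2.1; simp only [t]; linarith
  have ht1 : ∀ x, t x < 1 := fun x => by have := x.2.2; simp only [t]; linarith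
  have ht : ∀ x y, x < y → t x < t y := fun x y h => by
    have : (x : ℝ) < y := h
    simp only [t]; linarith
  let G : unitInterval → ℝ := fun x => L x + t x * (H x - L x)
  have hG : ∀ x, (L x : ℝ) ≤ G x ∧ G x ≤ H x := fun x => by
    have h : (L x : ℝ) ≤ H x := hLH x
    have h0 := ht0 x
    have h1 := ht1 x
    constructor <;> simp only [G] <;> nlinarith
  refine ⟨fun x => ⟨G x, (L x).2.1.trans (hG x).1, (hG x).2.trans (H x).2.2⟩, fun x y hxy => ?_,
    fun x => hG x⟩
  change G x < G y
  have hLx : (L x : ℝ) ≤ L y := hL hxy.le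
  have hHx : (H x : ℝ) ≤ H y := hH hxy.le
  have h : (L x : ℝ) ≤ H x := hLH x
  have hs : (L x : ℝ) < H y := hlt x y hxy
  have h1 := ht1 y
  have h0 := ht0 y
  have h2 := ht x y hxy
  -- Replacing `L y` by `L x` lowers `G y`, and replacing `H x` by `H y` raises `G x`. The two
  -- combinations then have the same ends and differ only in the weight.
  have hy : (L x : ℝ) + t y * (H y - L x) ≤ G y := by simp only [G]; nlinarith
  have hx : t x * ((H x : ℝ) - L x) < t y * (H y - L x) := by
    rcases h.eq_or_lt with h | h
    · rw [← h, sub_self, mul_zero]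
      exact mul_pos h0 (sub_pos.2 hs)
    · exact mul_lt_mul h2 (by linarith) (by linarith) h0.le
  simp only [G] at hy ⊢
  linarith

/-- Strictly increasing interpolation between finitely many lower bounds `p.2 ≤ g p.1`, `p ∈ A`,
and finitely many upper bounds `g q.1 ≤ q.2`, `q ∈ B`. -/
theorem exists_strictMono_interpolation (A B : Finset (unitInterval × unitInterval))
    (hle : ∀ p ∈ A, ∀ q ∈ B, p.1 ≤ q.1 → p.2 ≤ q.2)
    (hlt : ∀ p ∈ A, ∀ q ∈ B, p.1 < q.1 → p.2 < q.2)
    (hA0 : ∀ p ∈ A, p.1 = 0 → p.2 = 0) (hA1 : ∀ p ∈ A, p.1 < 1 → p.2 < 1)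
    (hB0 : ∀ q ∈ B, 0 < q.1 → 0 < q.2) (hB1 : ∀ q ∈ B, q.1 = 1 → q.2 = 1) :
    ∃ g : unitInterval → unitInterval, StrictMono g ∧ g 0 = 0 ∧ g 1 = 1 ∧
      (∀ p ∈ A, p.2 ≤ g p.1) ∧ ∀ q ∈ B, g q.1 ≤ q.2 := by
  have h01 : ∀ x : unitInterval, 0 ≤ x ∧ x ≤ 1 :=
    fun x => ⟨unitInterval.nonneg', unitInterval.le_one'⟩
  -- The endpoint conditions on `g` become two further lower and upper bounds; they also keep the
  -- sets defining `L` and `H` non-empty.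
  let A' := insert (0, 0) (insert (1, 1) A)
  let B' := insert (0, 0) (insert (1, 1) B)
  have hle' : ∀ p ∈ A', ∀ q ∈ B', p.1 ≤ q.1 → p.2 ≤ q.2 := by
    simp only [A', B', Finset.forall_mem_insert]
    refine ⟨⟨by simp, by simp, fun q _ _ => (h01 _).1⟩,
      ⟨by simp, by simp, fun q hq h => (hB1 q hq (le_antisymm (h01 _).2 h)).ge⟩,
      fun p hp => ⟨fun h => (hA0 p hp (le_antisymm h (h01 _).1)).le, fun _ => (h01 _).2,
        hle p hp⟩⟩
  have hlt' : ∀ p ∈ A', ∀ q ∈ B', p.1 < q.1 → p.2 < q.2 := by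
    simp only [A', B', Finset.forall_mem_insert]
    exact ⟨⟨by simp, by simp, hB0⟩,
      ⟨by simp, by simp, fun q hq h => absurd h (h01 _).2.not_gt⟩,
      fun p hp => ⟨fun h => absurd h (h01 _).1.not_gt, hA1 p hp, hlt p hp⟩⟩
  let L : unitInterval → unitInterval := fun x => (A'.filter fun p => p.1 ≤ x).sup Prod.snd
  let H : unitInterval → unitInterval := fun x => (B'.filter fun q => x ≤ q.1).inf Prod.snd
  have hL : ∀ x, ∃ p ∈ A', p.1 ≤ x ∧ L x = p.2 := fun x => by
    obtain ⟨p, hp, hp'⟩ := Finset.exists_mem_eq_sup (A'.filter fun p => p.1 ≤ x)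
      ⟨(0, 0), by simp [A', (h01 x).1]⟩ Prod.snd
    exact ⟨p, (Finset.mem_filter.1 hp).1, (Finset.mem_filter.1 hp).2, hp'⟩
  have hH : ∀ x, ∃ q ∈ B', x ≤ q.1 ∧ H x = q.2 := fun x => by
    obtain ⟨q, hq, hq'⟩ := Finset.exists_mem_eq_inf (B'.filter fun q => x ≤ q.1)
      ⟨(1, 1), by simp [B', (h01 x).2]⟩ Prod.snd
    exact ⟨q, (Finset.mem_filter.1 hq).1, (Finset.mem_filter.1 hq).2, hq'⟩
  have hLp : ∀ p ∈ A', p.2 ≤ L p.1 := fun p hp =>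
    Finset.le_sup (f := Prod.snd) (Finset.mem_filter.2 ⟨hp, le_rfl⟩)
  have hHq : ∀ q ∈ B', H q.1 ≤ q.2 := fun q hq =>
    Finset.inf_le (f := Prod.snd) (Finset.mem_filter.2 ⟨hq, le_rfl⟩)
  obtain ⟨g, hg, hgb⟩ := exists_strictMono_between (L := L) (H := H)
    (fun x y hxy => Finset.sup_mono fun p hp => by
      rw [Finset.mem_filter] at hp ⊢; exact ⟨hp.1, hp.2.trans hxy⟩)
    (fun x y hxy => Finset.inf_mono fun q hq => by
      rw [Finset.mem_filter] at hq ⊢; exact ⟨hq.1, hxy.trans hq.2⟩)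
    (fun x => by
      obtain ⟨p, hp, hpx, hp'⟩ := hL x
      obtain ⟨q, hq, hqx, hq'⟩ := hH x
      rw [hp', hq']
      exact hle' p hp q hq (hpx.trans hqx))
    (fun x y hxy => by
      obtain ⟨p, hp, hpx, hp'⟩ := hL x
      obtain ⟨q, hq, hqx, hq'⟩ := hH y
      rw [hp', hq']
      exact hlt' p hp q hq (hpx.trans_lt (hxy.trans_le hqx)))
  have hgA : ∀ p ∈ A', p.2 ≤ g p.1 := fun p hp => (hLp p hp).trans (hgb _).1
  have hgB : ∀ q ∈ B', g q.1 ≤ q.2 := fun q hq => (hgb _).2.trans (hHq q hq)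
  exact ⟨g, hg, le_antisymm (hgB (0, 0) (by simp [B'])) (h01 _).1,
    le_antisymm (h01 _).2 (hgA (1, 1) (by simp [A'])),
    fun p hp => hgA p (by simp [A', hp]), fun q hq => hgB q (by simp [B', hq])⟩

/-! ### Modal properties of valuations of `K45(G)` -/

namespace IsK45Hom

variable {v : Formula V → unitInterval}

theorem le_of_thm (hv : IsK45Hom v) {φ ψ : Formula V} (h : K45G (φ.imp ψ)) : v φ ≤ v ψ :=
  hv.imp_eq_one.1 (hv.of_thm h)

theorem min_le_of_thm (hv : IsK45Hom v) {φ ψ χ : Formula V} (h : K45G (φ.imp (ψ.imp χ))) :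
    min (v φ) (v ψ) ≤ v χ := by
  rw [← le_godelImp_iff, ← hv.imp]
  exact hv.le_of_thm h

theorem box_le_box (hv : IsK45Hom v) {φ ψ : Formula V} (h : K45G (φ.imp ψ)) :
    v φ.box ≤ v ψ.box :=
  hv.le_of_thm ((K45G.kBox φ ψ).mp h.nec)

theorem dia_bot (hv : IsK45Hom v) : v Formula.bot.dia = 0 :=
  le_antisymm ((hv.le_of_thm .fDia).trans hv.bot.le) unitInterval.nonneg'

theorem dia_or_le (hv : IsK45Hom v) (φ ψ : Formula V) :
    v (φ.or ψ).dia ≤ max (v φ.dia) (v ψ.dia) :=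
  (hv.le_of_thm (.kDia φ ψ)).trans (hv.or _ _).le

theorem box_imp_eq_one (hv : IsK45Hom v) {φ ψ : Formula V} (h : v φ.dia ≤ v ψ.box) :
    v (φ.imp ψ).box = 1 :=
  le_antisymm unitInterval.le_one' ((hv.imp_eq_one.2 h).ge.trans (hv.le_of_thm (.fs2 φ ψ)))

/-- This encodes a strict inequality by a box of value `1`: a Gödel valuation makes `(ψ → φ) → ψ`
true exactly when `φ` lies strictly below `ψ` or `ψ` has value `1`. Since `ψ` implies `(ψ → φ) → φ`,
axiom `p` forces `◇(ψ → φ)` down to `◇φ`, and then `fs2` applies. -/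
theorem box_imp_imp_eq_one [Countable V] (hv : IsK45Hom v) {φ ψ : Formula V}
    (h : v φ.dia < v ψ.box) : v ((ψ.imp φ).imp ψ).box = 1 := by
  refine hv.box_imp_eq_one ?_
  have h1 : v ψ.box ≤ v ((ψ.imp φ).imp φ).box := hv.box_le_box (.of_forall_godelHom fun u hu => by
    rw [hu.imp_eq_one, hu.imp, hu.imp, le_godelImp_iff]
    exact min_godelImp_le _ _)
  have h2 := hv.min_le_of_thm (.p (ψ.imp φ) φ)
  rcases min_le_iff.1 h2 with h3 | h3
  · exact absurd (h1.trans h3) h.not_ge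
  · exact h3.trans h.le

end IsK45Hom

/-! ### Valuations whose order is compatible with `v`, and their rescaling. -/

/-- `u` is compatible with the order that `v` prescribes for the values in accessible worlds. -/
structure IsAccessible (v u : Formula V → unitInterval) : Prop extends IsGodelHom u where
  le {φ ψ : Formula V} : v φ.dia ≤ v ψ.box → u φ ≤ u ψ
  lt {φ ψ : Formula V} : v φ.dia < v ψ.box → u φ < u ψ ∨ u φ = 1

theorem IsAccessible.of_box_eq_one [Countable V] {v u : Formula V → unitInterval}
    (hv : IsK45Hom v) (hu : IsGodelHom u) (h : ∀ ψ, v ψ.box = 1 → u ψ = 1) :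
    IsAccessible v u where
  toIsGodelHom := hu
  le h1 := hu.imp_eq_one.1 (h _ (hv.box_imp_eq_one h1))
  lt {φ ψ} h1 := by
    have h2 := h _ (hv.box_imp_imp_eq_one h1)
    rw [hu.imp_eq_one] at h2
    rcases lt_or_ge (u φ) (u ψ) with h3 | h3
    · exact .inl h3
    · rw [hu.imp_eq_one.2 h3] at h2
      exact .inr (le_antisymm unitInterval.le_one' (h2.trans h3))

/-- Rescaling an accessible valuation so that finitely many bounds by the values of boxes and
diamonds hold. -/
theorem IsAccessible.exists_rescaling {v u : Formula V → unitInterval} (hv : IsK45Hom v)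
    (hu : IsAccessible v u) (A B : Finset (Formula V)) {φ : Formula V} {β : unitInterval}
    (hA : ∀ ψ ∈ A, v ψ.box < β) (hB : ∀ ψ ∈ B, u ψ < 1) (hβ : 0 < β) (hφ : u φ = 1 → β = 1) :
    ∃ g : unitInterval → unitInterval, IsGodelHom (g ∘ u) ∧ StrictMono g ∧ g 1 = 1 ∧
      (∀ ψ ∈ A, v ψ.box ≤ g (u ψ)) ∧ (∀ ψ ∈ B, g (u ψ) ≤ v ψ.dia) ∧ g (u φ) ≤ β := by
  classical
  have h01 : ∀ x : unitInterval, 0 ≤ x ∧ x ≤ 1 :=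
    fun x => ⟨unitInterval.nonneg', unitInterval.le_one'⟩
  obtain ⟨g, hg, h0, h1, hgA, hgB⟩ := exists_strictMono_interpolation
    (A.image fun ψ => (u ψ, v ψ.box)) (insert (u φ, β) (B.image fun ψ => (u ψ, v ψ.dia)))
    (by
      simp only [Finset.forall_mem_insert, Finset.forall_mem_image]
      refine fun ψ hψ => ⟨fun _ => (hA ψ hψ).le, fun χ hχ h => ?_⟩
      -- A lower bound above an upper bound would mean `v χ.dia < v ψ.box`. The exceptional case `u
      -- χ = 1` of `hu.lt` is excluded by `hB`.
      by_contra! hcon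
      rcases hu.lt hcon with h' | h'
      · exact h'.not_ge h
      · exact (hB χ hχ).ne h')
    (by
      simp only [Finset.forall_mem_insert, Finset.forall_mem_image]
      refine fun ψ hψ => ⟨fun _ => hA ψ hψ, fun χ hχ h => ?_⟩
      by_contra! hcon
      exact (hu.le hcon).not_gt h)
    (by
      simp only [Finset.forall_mem_image]
      intro ψ hψ h
      by_contra hne
      -- As `v (◇⊥) = 0`, a positive box value forces `u ψ` strictly above `u ⊥ = 0`.
      rcases hu.lt (φ := .bot) (ψ := ψ) (hv.dia_bot ▸ lt_of_le_of_ne (h01 _).1 (Ne.symm hne))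
        with h' | h'
      · rw [h, hu.bot] at h'; exact lt_irrefl _ h'
      · rw [hu.bot] at h'; exact zero_ne_one h')
    (by
      simp only [Finset.forall_mem_image]
      exact fun ψ hψ _ => (hA ψ hψ).trans_le (h01 _).2)
    (by
      simp only [Finset.forall_mem_insert, Finset.forall_mem_image]
      refine ⟨fun _ => hβ, fun ψ _ h => ?_⟩
      by_contra! hcon
      exact ((hu.le (hcon.trans (h01 (v Formula.bot.box)).1)).trans hu.bot.le).not_gt h)
    (by
      simp only [Finset.forall_mem_insert, Finset.forall_mem_image]
      exact ⟨hφ, fun ψ hψ h => absurd h (hB ψ hψ).ne⟩)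
  simp only [Finset.forall_mem_insert, Finset.forall_mem_image] at hgA hgB
  exact ⟨g, hu.comp hg h0 h1, hg, h1, fun ψ hψ => hgA hψ, fun ψ hψ => hgB.2 hψ, hgB.1⟩

/-! ### The canonical model -/

/-- The possibility degree of `u` as seen from `v`, computed on a finite set of formulas. -/
noncomputable def possibility (v : Formula V → unitInterval) (F : Finset (Formula V))
    (u : Formula V → unitInterval) : unitInterval :=
  F.inf fun ψ => min (godelImp (v ψ.box) (u ψ)) (godelImp (u ψ) (v ψ.dia))

/-! ### Witnesses for boxes and diamonds. -/

section Possibility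

variable {v u : Formula V → unitInterval} {F : Finset (Formula V)} {φ : Formula V}

theorem le_possibility_iff {a : unitInterval} :
    a ≤ possibility v F u ↔
      ∀ ψ ∈ F, min a (v ψ.box) ≤ u ψ ∧ min a (u ψ) ≤ v ψ.dia := by
  simp only [possibility, Finset.le_inf_iff, le_min_iff, le_godelImp_iff]

theorem min_possibility_box_le (h : φ ∈ F) : min (possibility v F u) (v φ.box) ≤ u φ :=
  (le_possibility_iff.1 le_rfl φ h).1

theorem min_possibility_le_dia (h : φ ∈ F) : min (possibility v F u) (u φ) ≤ v φ.dia :=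
  (le_possibility_iff.1 le_rfl φ h).2

variable [Countable V]

/-- The formulas whose box exceeds `v φ.box` form a theory by axiom K, and it omits `φ`; hence some
`u` makes them all `1` while `u φ < 1`. Rescaling brings `φ` below `γ`. The strict inequality
ensures that the cut-off at the degree of the witness leaves the value of `φ` untouched. -/
theorem IsK45Hom.exists_box_witness (hv : IsK45Hom v) (F : Finset (Formula V))
    {γ : unitInterval} (hγ : v φ.box < γ) :
    ∃ u, IsGodelHom u ∧ u φ ≤ γ ∧ u φ < possibility v F u := by
  have hT : IsTheory {ψ : Formula V | v φ.box < v ψ.box} := by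
    refine ⟨fun h => ?_, fun {ψ χ} h1 h2 => ?_⟩
    · change _ < v _
      rw [hv.of_thm h.nec]
      exact hγ.trans_le unitInterval.le_one'
    · exact (lt_min h1 h2).trans_le (hv.min_le_of_thm (.kBox ψ χ))
  obtain ⟨u, hu, hu1, hlt⟩ := hT.exists_godelHom_extending (U := {φ}) ⟨φ, rfl⟩
    (by rintro a rfl b rfl; exact ⟨_, rfl, .refl _, .refl _⟩)
    (by rintro a rfl h; exact lt_irrefl (v a.box) h)
  replace hlt := hlt φ rfl
  have hacc : IsAccessible v u := .of_box_eq_one hv hu fun ψ h => hu1 ψ (by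
    change _ < v _
    rw [h]; exact hγ.trans_le unitInterval.le_one')
  -- Besides `γ`, the bound `β` stays below every diamond value in `F` exceeding `v φ.box`; there is
  -- room because `F` is finite.
  obtain ⟨β, hβ, hβ'⟩ : ∃ β, v φ.box < β ∧
      β < min γ ((F.filter fun ψ => v φ.box < v ψ.dia).inf fun ψ => v ψ.dia) := by
    refine exists_between (lt_min hγ ?_)
    rw [Finset.lt_inf_iff (hγ.trans_le le_top)]
    exact fun ψ hψ => (Finset.mem_filter.1 hψ).2
  rw [lt_min_iff] at hβ'
  obtain ⟨g, hgu, hg, hg1, hgA, hgB, hgφ⟩ := hacc.exists_rescaling hv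
    (F.filter fun ψ => v ψ.box ≤ v φ.box) (F.filter fun ψ => v ψ.dia ≤ v φ.box) (φ := φ)
    (fun ψ hψ => (Finset.mem_filter.1 hψ).2.trans_lt hβ)
    (fun ψ hψ => (hacc.le (Finset.mem_filter.1 hψ).2).trans_lt hlt)
    (unitInterval.nonneg'.trans_lt hβ) (fun h => absurd h hlt.ne)
  have hgφ1 : g (u φ) < 1 := hg1 ▸ hg hlt
  refine ⟨g ∘ u, hgu, hgφ.trans hβ'.1.le, ?_⟩
  refine (Finset.lt_inf_iff (f := fun ψ => min (godelImp (v ψ.box) ((g ∘ u) ψ))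
    (godelImp ((g ∘ u) ψ) (v ψ.dia))) hgφ1).2 fun ψ hψ => lt_min ?_ ?_
  · rw [godelImp_of_le]
    · exact hgφ1
    · rcases le_or_gt (v ψ.box) (v φ.box) with h | h
      · exact hgA ψ (Finset.mem_filter.2 ⟨hψ, h⟩)
      · simp [hu1 ψ h, hg1, unitInterval.le_one']
  · rcases le_or_gt (v ψ.dia) (v φ.box) with h | h
    · rw [godelImp_of_le]
      · exact hgφ1
      · exact hgB ψ (Finset.mem_filter.2 ⟨hψ, h⟩)
    -- No upper bound was imposed on this `ψ`: the implication is at least `v ψ.dia`, which already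
    -- exceeds `β`.
    · refine lt_of_lt_of_le ?_ (le_godelImp_right _ _)
      exact hgφ.trans_lt (hβ'.2.trans_le (Finset.inf_le (Finset.mem_filter.2 ⟨hψ, h⟩)))

/-- The theory collects what follows from `φ` to degree `v φ.dia`. It must avoid all formulas with a
smaller diamond: these are directed because `◇` distributes over `∨`, and axiom `p` keeps them out
of the theory. For larger diamonds the cut-off at `v φ.dia` makes the upper bound automatic. -/
theorem IsK45Hom.exists_dia_witness (hv : IsK45Hom v) (F : Finset (Formula V))
    (hφ : 0 < v φ.dia) :
    ∃ u, IsGodelHom u ∧ u φ = 1 ∧ v φ.dia ≤ possibility v F u := by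
  have hT : IsTheory {ψ : Formula V | v φ.dia ≤ v (φ.imp ψ).box} := by
    refine ⟨fun {ψ} h => ?_, fun {ψ χ} h1 h2 => ?_⟩
    · change _ ≤ v _
      rw [hv.of_thm ((K45G.weaken ψ φ).mp h).nec]
      exact unitInterval.le_one'
    · refine (le_min (le_trans h1 (hv.box_le_box ?_)) h2).trans
        (hv.min_le_of_thm (.kBox (φ.imp ψ) (φ.imp χ)))
      refine .of_forall_godelHom fun u hu => ?_
      rw [hu.imp_eq_one]
      simp only [hu.imp, le_godelImp_iff]
      have h1 := min_godelImp_le (u φ) (godelImp (u ψ) (u χ))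
      have h2 := min_godelImp_le (u φ) (u ψ)
      have h3 := min_godelImp_le (u ψ) (u χ)
      grind
  have hbox : ∀ ψ : Formula V, v φ.dia ≤ v ψ.box → v φ.dia ≤ v (φ.imp ψ).box :=
    fun ψ h => h.trans (hv.box_le_box (.weaken ψ φ))
  obtain ⟨u, hu, hu1, hlt⟩ := hT.exists_godelHom_extending
    (U := {ψ | v ψ.dia < v φ.dia}) ⟨.bot, by simpa [hv.dia_bot] using hφ⟩
    (fun a ha b hb => ⟨a.or b, (hv.dia_or_le a b).trans_lt (max_lt ha hb),
      .of_forall_godelHom fun u hu => by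
        rw [hu.imp_eq_one, hu.or]; exact le_max_left _ _,
      .of_forall_godelHom fun u hu => by
        rw [hu.imp_eq_one, hu.or]; exact le_max_right _ _⟩)
    (fun a ha h => by
      have h1 := (le_min h le_rfl).trans (hv.min_le_of_thm (.p φ a))
      exact h1.not_gt ha)
  have hacc : IsAccessible v u := .of_box_eq_one hv hu fun ψ h => hu1 ψ (hbox ψ (by
    rw [h]; exact unitInterval.le_one'))
  obtain ⟨g, hgu, hg, hg1, hgA, hgB, -⟩ := hacc.exists_rescaling hv
    (F.filter fun ψ => v ψ.box < v φ.dia) (F.filter fun ψ => v ψ.dia < v φ.dia)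
    -- This choice makes the extra bound of the rescaling lemma vacuous.
    (φ := .top) (β := 1)
    (fun ψ hψ => (Finset.mem_filter.1 hψ).2.trans_le unitInterval.le_one')
    (fun ψ hψ => hlt ψ (Finset.mem_filter.1 hψ).2) zero_lt_one (fun _ => rfl)
  have hφ1 : u φ = 1 := hu1 φ (by
    change _ ≤ v _
    rw [hv.of_thm (K45G.refl φ).nec]
    exact unitInterval.le_one')
  refine ⟨g ∘ u, hgu, by simp [hφ1, hg1], le_possibility_iff.2 fun ψ hψ => ⟨?_, ?_⟩⟩
  · rcases lt_or_ge (v ψ.box) (v φ.dia) with h | h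
    · exact (min_le_right _ _).trans (hgA ψ (Finset.mem_filter.2 ⟨hψ, h⟩))
    · simp [hu1 ψ (hbox ψ h), hg1, unitInterval.le_one']
  · rcases lt_or_ge (v ψ.dia) (v φ.dia) with h | h
    · exact (min_le_right _ _).trans (hgB ψ (Finset.mem_filter.2 ⟨hψ, h⟩))
    · exact (min_le_left _ _).trans h

end Possibility

open Classical in
/-- The formulas on which accessibility has to be controlled to evaluate a formula. -/
noncomputable def Formula.fragment : Formula V → Finset (Formula V)
  | var _ => ∅
  | bot => ∅
  | and φ ψ => fragment φ ∪ fragment ψ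
  | imp φ ψ => fragment φ ∪ fragment ψ
  | box φ => insert φ (insert φ.box (fragment φ))
  | dia φ => insert φ (insert φ.dia (fragment φ))

/-- The canonical model at `v`: all Gödel valuations with their possibility degree as seen from
`v`, and an impossible world that agrees with `v`. -/
noncomputable def canonicalModel [Countable V] (v : Formula V → unitInterval)
    (F : Finset (Formula V)) : PiGModel.{u, w} V where
  -- Countability of the formulas makes the set of valuations small in every universe, so the worlds
  -- can be placed in `Type w`.
  W := Option (Shrink.{w} {u : Formula V → unitInterval // IsGodelHom u})
  nonempty := ⟨none⟩
  π
    | none => 0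
    | some s => possibility v F ((equivShrink _).symm s).1
  e
    | none, x => v (.var x)
    | some s, x => ((equivShrink _).symm s).1 (.var x)

/-! ### The truth lemma. -/

section Canonical

variable [Countable V] {v : Formula V → unitInterval} {F : Finset (Formula V)}

/-- The valuation of all formulas that a world of the canonical model is built from. -/
noncomputable def canonicalValuation (v : Formula V → unitInterval) (F : Finset (Formula V)) :
    (canonicalModel.{u, w} v F).W → Formula V → unitInterval
  | none => v
  | some s => ((equivShrink _).symm s).1

theorem isGodelHom_canonicalValuation (hv : IsK45Hom v) (s : (canonicalModel.{u, w} v F).W) :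
    IsGodelHom (canonicalValuation v F s) := by
  cases s with
  | none => exact hv.toIsGodelHom
  | some s => exact ((equivShrink _).symm s).2

theorem exists_world {u : Formula V → unitInterval} (hu : IsGodelHom u) :
    ∃ s : (canonicalModel.{u, w} v F).W, canonicalValuation v F s = u ∧
      (canonicalModel.{u, w} v F).π s = possibility v F u :=
  ⟨some (equivShrink _ ⟨u, hu⟩), by simp [canonicalValuation], by simp [canonicalModel]⟩

theorem min_canonical_box_le {φ : Formula V} (h : φ ∈ F) (s : (canonicalModel.{u, w} v F).W) :
    min ((canonicalModel v F).π s) (v φ.box) ≤ canonicalValuation v F s φ := by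
  cases s with
  | none => exact (min_le_left _ _).trans unitInterval.nonneg'
  | some s => exact min_possibility_box_le h

theorem min_canonical_le_dia {φ : Formula V} (h : φ ∈ F) (s : (canonicalModel.{u, w} v F).W) :
    min ((canonicalModel v F).π s) (canonicalValuation v F s φ) ≤ v φ.dia := by
  cases s with
  | none => exact (min_le_left _ _).trans unitInterval.nonneg'
  | some s => exact min_possibility_le_dia h

/-- Truth lemma: up to the cut-off at the possibility degree of a world, formulas take their
canonical values; at the impossible world they do so without cut-off. -/
theorem canonicalModel_eval (hv : IsK45Hom v) {φ : Formula V} (hF : φ.fragment ⊆ F) :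
    (∀ s, min ((canonicalModel.{u, w} v F).π s) ((canonicalModel.{u, w} v F).eval φ s) =
      min ((canonicalModel.{u, w} v F).π s) (canonicalValuation v F s φ)) ∧
    (canonicalModel.{u, w} v F).eval φ none = v φ := by
  classical
  induction φ with
  | var x => exact ⟨fun s => by cases s <;> rfl, rfl⟩
  | bot => exact ⟨fun s => by rw [(isGodelHom_canonicalValuation hv s).bot]; rfl, hv.bot.symm⟩
  | and φ ψ ih1 ih2 =>
    obtain ⟨h1, h1'⟩ := ih1 (Finset.union_subset_left hF)
    obtain ⟨h2, h2'⟩ := ih2 (Finset.union_subset_right hF)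
    refine ⟨fun s => ?_, ?_⟩
    · rw [(isGodelHom_canonicalValuation hv s).and]
      refine (inf_inf_distrib_left _ _ _).trans (.trans ?_ (inf_inf_distrib_left _ _ _).symm)
      exact congrArg₂ min (h1 s) (h2 s)
    · rw [hv.and, ← h1', ← h2']; rfl
  | imp φ ψ ih1 ih2 =>
    obtain ⟨h1, h1'⟩ := ih1 (Finset.union_subset_left hF)
    obtain ⟨h2, h2'⟩ := ih2 (Finset.union_subset_right hF)
    refine ⟨fun s => ?_, ?_⟩
    · rw [(isGodelHom_canonicalValuation hv s).imp]
      exact min_godelImp_congr (h1 s) (h2 s)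
    · rw [hv.imp, ← h1', ← h2']; rfl
  | box φ ih =>
    rw [Formula.fragment, Finset.insert_subset_iff, Finset.insert_subset_iff] at hF
    obtain ⟨h1, -⟩ := ih hF.2.2
    have key : ∀ s, (canonicalModel.{u, w} v F).eval φ.box s = v φ.box := by
      intro s
      apply le_antisymm
      -- The value of `φ` at the witness is strictly below its degree, so the cut-off identity
      -- determines it as `u φ`, and the infimum is at most `u φ ≤ γ`.
      · refine le_of_forall_gt_imp_ge_of_dense fun γ hγ => ?_
        obtain ⟨u, hu, hγu, hlt⟩ := hv.exists_box_witness F hγ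
        obtain ⟨s', hs', hπ⟩ := exists_world.{u, w} (v := v) (F := F) hu
        have h2 := h1 s'
        have h3 := PiGModel.box_inf_le _ φ s s'
        rw [hs', hπ, min_eq_right hlt.le] at h2
        rw [hπ] at h3
        grind
      · refine PiGModel.le_box _ fun s' => ?_
        have h2 := h1 s'
        have h3 := min_canonical_box_le.{u, w} (v := v) hF.1 s'
        grind
    refine ⟨fun s => ?_, key none⟩
    rw [key]
    -- At `s` the formula `□φ` is an atom, but it belongs to `F`: up to the cut-off its value lies
    -- between `v (□□φ)` and `v (◇□φ)`, and introspection squeezes both to `v (□φ)`.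
    have h2 := min_canonical_box_le.{u, w} (v := v) hF.2.1 s
    have h3 := min_canonical_le_dia.{u, w} (v := v) hF.2.1 s
    have h4 := hv.le_of_thm (.fourBox φ)
    have h5 := hv.le_of_thm (.fiveBox φ)
    grind
  | dia φ ih =>
    rw [Formula.fragment, Finset.insert_subset_iff, Finset.insert_subset_iff] at hF
    obtain ⟨h1, -⟩ := ih hF.2.2
    have key : ∀ s, (canonicalModel.{u, w} v F).eval φ.dia s = v φ.dia := by
      intro s
      apply le_antisymm
      · refine PiGModel.dia_le _ fun s' => ?_
        rw [h1 s']
        exact min_canonical_le_dia hF.1 s'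
      · rcases eq_or_lt_of_le (unitInterval.nonneg' (t := v φ.dia)) with h0 | h0
        · rw [← h0]; exact unitInterval.nonneg'
        · obtain ⟨u, hu, hu1, hle⟩ := hv.exists_dia_witness F h0
          obtain ⟨s', hs', hπ⟩ := exists_world.{u, w} (v := v) (F := F) hu
          refine le_trans ?_ (PiGModel.le_dia _ φ s s')
          rw [h1 s', hs', hπ, hu1]
          exact le_min hle unitInterval.le_one'
    refine ⟨fun s => ?_, key none⟩
    rw [key]
    have h2 := min_canonical_box_le.{u, w} (v := v) hF.2.1 s
    have h3 := min_canonical_le_dia.{u, w} (v := v) hF.2.1 s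
    have h4 := hv.le_of_thm (.fourDia φ)
    have h5 := hv.le_of_thm (.fiveDia φ)
    grind

end Canonical

end

theorem theorem1 {V : Type u} [Countable V] (φ : Formula V) :
    PiGValid.{u, w} φ ↔ K45G φ := by
  refine ⟨fun h => ?_, fun h M => h.valid M⟩
  by_contra hφ
  obtain ⟨v, hv, hlt⟩ := exists_isK45Hom_lt_one hφ
  have h1 := (canonicalModel_eval.{u, w} (F := φ.fragment) hv subset_rfl).2
  exact hlt.ne (h1.symm.trans (h (canonicalModel v φ.fragment) none))
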